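/- Let $d\ge 1$ and $k\ge 0$ be integers, let $\Omega=\{x\in\mathbb{R}^d : \|x\|\ge 1\}$, let $\rho$ be the surface measure on the unit sphere $S^{d-1}\subset\mathbb{R}^d$ and let $|S^{d-1}|=\rho(S^{d-1})$ (so $|S^0|=2$). Consider the spherically symmetric integral $$I(f)=\int_\Omega f(x)\,\frac{\sqrt{\|x\|^2-1}}{\|x\|^{4k+d+2}}\,dx=\int_1^\infty\Big(\int_{S^{d-1}}f(rx)\,d\rho(x)\Big)\sqrt{r^2-1}\;r^{-(4k+3)}\,dr,$$ which is understood in the polar form on the right (for polynomials of degree $4k+1$ the volume integral need not converge absolutely). A cubature formula of degree $t$ for $I$ consists of a finite set $X\subset\mathbb{R}^d$ and weights $w(x)>0$, $x\in X$, such that $I(f)=\sum_{x\in X}w(x)f(x)$ for every real polynomial $f$ in $d$ variables of degree at most $t$. A cubature formula of degree $4k+1$ is called minimal if it attains Möller's lower bound, i.e. $|X|=2\dim\mathcal{P}^*_{2k}(\Omega)-1$, where $\mathcal{P}^*_{2k}(\Omega)$ is the space of restrictions to $\Omega$ of the even polynomials of degree at most $2k$. Let $(X,w)$ be a minimal formula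 of degree $4k+1$ for $I$. Then the points of $X$ are distributed over the origin and the $k$ distinct concentric spheres about the origin of radii $$r_i=\frac{1}{\cos\big(i\pi/(2k+1)\big)},\qquad i=1,\dots,k,$$ that is, $\{\|x\| : x\in X\}=\{0,r_1,\dots,r_k\}$. Moreover, for each $i=1,\dots,k$ the total weight on the $i$-th sphere is $$\sum_{x\in X,\ \|x\|=r_i}w(x)=\frac{\pi\,|S^{d-1}|}{2k+1}\,\sin^2\Big(\frac{i\pi}{2k+1}\Big)\cos^{4k}\Big(\frac{i\pi}{2k+1}\Big).$$ -/

import Mathlib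

open MeasureTheory

/-- Euclidean `d`-space. -/
abbrev CubSpace (d : ℕ) : Type := EuclideanSpace ℝ (Fin d)

/-- The value of a real polynomial in `d` variables at a point of Euclidean `d`-space. -/
noncomputable def polyVal {d : ℕ} (f : MvPolynomial (Fin d) ℝ) (x : CubSpace d) : ℝ :=
  MvPolynomial.eval (fun i => x i) f

/-- The surface measure `ρ` on the unit sphere `S^{d-1}`. -/
noncomputable def surfaceMeasure (d : ℕ) : Measure (Metric.sphere (0 : CubSpace d) 1) :=
  (volume : Measure (CubSpace d)).toSphere

/-- The total surface area `|S^{d-1}|`. -/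
noncomputable def sphereArea (d : ℕ) : ℝ := (surfaceMeasure d).real Set.univ

/-- The integral of `f` against the radial weight `W(‖x‖)` over the region `‖x‖ ∈ I`, in polar
coordinates: `∫_I (∫_{S^{d-1}} f (r x) dρ(x)) r^{d-1} W(r) dr`. -/
noncomputable def sphericalIntegral (d : ℕ) (I : Set ℝ) (W : ℝ → ℝ) (f : CubSpace d → ℝ) : ℝ :=
  ∫ r in I, (∫ x : Metric.sphere (0 : CubSpace d) 1, f (r • (x : CubSpace d)) ∂(surfaceMeasure d)) *
    (r ^ (d - 1) * W r)

/-- The weight `√(r² - 1) / r^{4k+d+2}`. -/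
noncomputable def specialWeight (d k : ℕ) (r : ℝ) : ℝ := √(r ^ 2 - 1) / r ^ (4 * k + d + 2)

/-- The special integral over `‖x‖ ≥ 1`, with weight `√(‖x‖² - 1) / ‖x‖^{4k+d+2}`.
Polynomials of degree `4k+1` need not be absolutely integrable for this weight (the odd part of
degree `4k+1` is not), and the polar form is the sense in which the integral exists for them. -/
noncomputable def specialIntegral (d k : ℕ) (f : CubSpace d → ℝ) : ℝ :=
  sphericalIntegral d (Set.Ici 1) (specialWeight d k) f

/-- The region `{x : 1 ≤ ‖x‖}` of the special integral. -/
def specialRegion (d : ℕ) : Set (CubSpace d) := {x | 1 ≤ ‖x‖}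

/-- The finite point set `X` with the weights `w` is a cubature formula of degree `t` for the
integral `L`: the weights are positive and the formula is exact on all polynomials of degree
at most `t`. -/
structure IsCubature {d : ℕ} (L : (CubSpace d → ℝ) → ℝ) (t : ℕ)
    (X : Finset (CubSpace d)) (w : CubSpace d → ℝ) : Prop where
  pos : ∀ x ∈ X, 0 < w x
  exact : ∀ f : MvPolynomial (Fin d) ℝ, f.totalDegree ≤ t →
    L (polyVal f) = ∑ x ∈ X, w x * polyVal f x

/-- Restriction of polynomials to functions on `Ω`, as a linear map. -/
noncomputable def polyRestrict {d : ℕ} (Ω : Set (CubSpace d)) :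
    MvPolynomial (Fin d) ℝ →ₗ[ℝ] (Ω → ℝ) where
  toFun f x := polyVal f x
  map_add' f g := by ext x; simp [polyVal]
  map_smul' c f := by ext x; simp [polyVal]

/-- The polynomials with `f (-x) = (-1)^n f x`: the even ones for even `n`, the odd ones for
odd `n`. -/
noncomputable def parityPoly (d n : ℕ) : Submodule ℝ (MvPolynomial (Fin d) ℝ) where
  carrier := {f | ∀ x : CubSpace d, polyVal f (-x) = (-1) ^ n * polyVal f x}
  add_mem' {f g} hf hg x := by
    have h1 := hf x
    have h2 := hg x
    simp only [polyVal, map_add] at h1 h2 ⊢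
    rw [h1, h2]; ring
  zero_mem' x := by simp [polyVal]
  smul_mem' c f hf x := by
    have h1 := hf x
    simp only [polyVal, MvPolynomial.smul_eval] at h1 ⊢
    rw [h1]; ring

/-- The space `𝒫*_n(Ω)` of restrictions to `Ω` of the polynomials of degree at most `n` that are
even or odd according to the parity of `n`. -/
noncomputable def parityPolyOn {d : ℕ} (n : ℕ) (Ω : Set (CubSpace d)) : Submodule ℝ (Ω → ℝ) :=
  (MvPolynomial.restrictTotalDegree (Fin d) ℝ n ⊓ parityPoly d n).map (polyRestrict Ω)

/-- A minimal formula of degree `4k+1` for the special integral: a cubature formula of degree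
`4k+1` whose number of points attains Möller's lower bound `2 dim 𝒫*_{2k}(Ω) - 1`. -/
structure IsMinimalFormula (d k : ℕ) (X : Finset (CubSpace d)) (w : CubSpace d → ℝ) : Prop where
  isCubature : IsCubature (specialIntegral d k) (4 * k + 1) X w
  card_eq : X.card + 1 = 2 * Module.finrank ℝ (parityPolyOn (2 * k) (specialRegion d))

/-- The radius `1 / cos (iπ/(2k+1))` of the `i`-th sphere. -/
noncomputable def layerRadius (k i : ℕ) : ℝ := 1 / Real.cos (i * Real.pi / (2 * k + 1))

/-! Under `r = 1 / cos θ` the radial moment of `r ^ (2m)` becomes the integral of `sin² θ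
cos^(2(2k-m)) θ` over `[0, π/2]`. The equidistant rule with `2k+1` nodes on a period `π` computes it
exactly for `1 ≤ m ≤ 2k`, and reflection leaves `k` nodes, which are the layers. Only `m = 0` can
fail, and that moment sees only `f 0`. Hence, up to degree `4k+1`, the integral is `c * f 0` plus
weighted sphere integrals over the layers (`exists_specialIntegral_eq_sum`).

Let `V` be the even polynomials of degree at most `2k` restricted to `X`, and `L` a linear form
vanishing at no nonzero node. Exactness on odd polynomials makes `V` and `L * V` orthogonal in
`ℓ²(X, w)`. Since the integral is definite on squares, `dim V` is at least the dimension in Möller's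
bound; when the bound is attained, the origin is a node and `V ⊕ L * V` is everything
(`IsMinimalFormula.zero_mem_and_eq_zero`).

Let `g(‖x‖²)` vanish on all layers. Corrected at the origin, it is orthogonal to both summands,
hence zero on `X`, so every other node lies on a layer (`IsMinimalFormula.norm_mem`). Radial test
polynomials isolating one layer then give its weight; as this is positive, no layer is empty. -/

/-! ### Equidistant quadrature for trigonometric polynomials -/

theorem integral_cos_even_mul {q : ℤ} (hq : q ≠ 0) :
    ∫ θ in (0 : ℝ)..(Real.pi / 2), Real.cos (2 * q * θ) = 0 := by
  have hq' : (q : ℝ) ≠ 0 := by exact_mod_cast hq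
  have h2 : (2 * q : ℝ) ≠ 0 := by positivity
  rw [intervalIntegral.integral_comp_mul_left (fun x => Real.cos x) h2, integral_cos]
  have : (2 * (q : ℝ) * (Real.pi / 2)) = q * Real.pi := by ring
  simp [this, Real.sin_int_mul_pi]

theorem sum_cos_even_mul {n : ℕ} {q : ℤ} (hq : q ≠ 0) (hn : |q| < n) :
    ∑ i ∈ Finset.range n, Real.cos (2 * q * (i * Real.pi / n)) = 0 := by
  have hn0 : (0 : ℝ) < n := by
    have : 0 < (n : ℤ) := lt_of_le_of_lt (abs_nonneg q) hn
    exact_mod_cast this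
  set φ : ℝ := q * Real.pi / n with hφ
  -- `sin φ = 0` would force `n ∣ q`, impossible for `0 < |q| < n`. So the sum may be multiplied by
  -- `2 sin φ`, after which it telescopes.
  have hsin : Real.sin φ ≠ 0 := by
    rw [Ne, Real.sin_eq_zero_iff]
    rintro ⟨m, hm⟩
    have hm' : (m : ℝ) * n = q := by
      rw [hφ, eq_div_iff hn0.ne'] at hm
      have := Real.pi_pos.ne'
      apply mul_right_cancel₀ this
      linarith
    have hm2 : m * (n : ℤ) = q := by exact_mod_cast hm'
    exact hq (Int.eq_zero_of_abs_lt_dvd (Dvd.intro_left m hm2) hn)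
  have tel : ∀ N : ℕ, 2 * Real.sin φ * ∑ i ∈ Finset.range N, Real.cos (2 * q * (i * Real.pi / n))
      = Real.sin (φ * (2 * N - 1)) + Real.sin φ := by
    intro N
    induction N with
    | zero => simp
    | succ N ih =>
      rw [Finset.sum_range_succ, mul_add, ih]
      have e1 : 2 * (q : ℝ) * (N * Real.pi / n) = 2 * φ * N := by rw [hφ]; ring
      have e2 : φ * (2 * ((N + 1 : ℕ) : ℝ) - 1) = 2 * φ * N + φ := by push_cast; ring
      have e3 : φ * (2 * (N : ℝ) - 1) = 2 * φ * N - φ := by ring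
      rw [e1, e2, e3, Real.sin_add, Real.sin_sub]
      ring
  have h := tel n
  have e : φ * (2 * (n : ℝ) - 1) = q * (2 * Real.pi) - φ := by
    rw [hφ]; field_simp
  rw [e, Real.sin_int_mul_two_pi_sub] at h
  simpa [hsin] using h

/-- The `n`-point equidistant rule is exact for the even trigonometric polynomials of degree less
than `n` in `2θ`. -/
theorem integral_cos_pow_mul_cos_eq_sum {n : ℕ} (p : ℕ) :
    ∀ q : ℤ, p + |q| < n →
    ∫ θ in (0 : ℝ)..(Real.pi / 2), Real.cos θ ^ (2 * p) * Real.cos (2 * q * θ) =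
      Real.pi / (2 * n) * ∑ i ∈ Finset.range n,
        Real.cos (i * Real.pi / n) ^ (2 * p) * Real.cos (2 * q * (i * Real.pi / n)) := by
  induction p with
  | zero =>
    intro q hq
    by_cases h0 : q = 0
    · subst h0
      have hn : (n : ℝ) ≠ 0 := by
        have : 0 < (n : ℤ) := by simpa using hq
        have : (0 : ℝ) < n := by exact_mod_cast this
        exact this.ne'
      simp
      field_simp
    · have := integral_cos_even_mul h0
      have h2 := sum_cos_even_mul (n := n) h0 (by simpa using hq)
      simp [this, h2]
  | succ p ih =>
    intro q hq
    -- Trading a factor `cos² θ` for the shifts `q ± 1` preserves the bound on `p + |q|`; this is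
    -- why the induction runs over all `q`.
    have key : ∀ θ : ℝ, Real.cos θ ^ (2 * (p + 1)) * Real.cos (2 * q * θ) =
        1 / 2 * (Real.cos θ ^ (2 * p) * Real.cos (2 * q * θ)) +
        1 / 4 * (Real.cos θ ^ (2 * p) * Real.cos (2 * ((q + 1 : ℤ) : ℝ) * θ)) +
        1 / 4 * (Real.cos θ ^ (2 * p) * Real.cos (2 * ((q - 1 : ℤ) : ℝ) * θ)) := by
      intro θ
      have e1 : 2 * ((q + 1 : ℤ) : ℝ) * θ = 2 * q * θ + 2 * θ := by push_cast; ring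
      have e2 : 2 * ((q - 1 : ℤ) : ℝ) * θ = 2 * q * θ - 2 * θ := by push_cast; ring
      rw [e1, e2, Real.cos_add, Real.cos_sub, Real.cos_two_mul]
      ring
    have ha := abs_add_le q 1
    have hb := abs_sub q 1
    push_cast at hq
    simp only [abs_one] at ha hb
    simp_rw [key]
    have hi : ∀ q : ℤ, IntervalIntegrable
        (fun θ : ℝ => Real.cos θ ^ (2 * p) * Real.cos (2 * q * θ)) volume 0 (Real.pi / 2) :=
      fun q => Continuous.intervalIntegrable (by fun_prop) _ _
    rw [intervalIntegral.integral_add (((hi _).const_mul _).add ((hi _).const_mul _))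
      ((hi _).const_mul _), intervalIntegral.integral_add ((hi _).const_mul _) ((hi _).const_mul _)]
    simp only [intervalIntegral.integral_const_mul, Finset.sum_add_distrib, ← Finset.mul_sum]
    rw [ih q (by lia), ih (q + 1) (by lia), ih (q - 1) (by lia)]
    ring

theorem integral_cos_pow_eq_sum {n p : ℕ} (h : p < n) :
    ∫ θ in (0 : ℝ)..(Real.pi / 2), Real.cos θ ^ (2 * p) =
      Real.pi / (2 * n) * ∑ i ∈ Finset.range n, Real.cos (i * Real.pi / n) ^ (2 * p) := by
  have := integral_cos_pow_mul_cos_eq_sum (n := n) p 0 (by simpa using h)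
  simpa using this

/-- The reflection `i ↦ 2k+1-i` pairs the nonzero indices without a fixed point, because `2k+1` is
odd. -/
theorem sum_range_reflect_pi {k : ℕ} {F : ℝ → ℝ} (h0 : F 0 = 0)
    (hF : ∀ θ, F (Real.pi - θ) = F θ) :
    ∑ i ∈ Finset.range (2 * k + 1), F (i * Real.pi / (2 * k + 1)) =
      2 * ∑ i ∈ Finset.Icc 1 k, F (i * Real.pi / (2 * k + 1)) := by
  have h1 : ∑ i ∈ Finset.range (2 * k + 1), F (i * Real.pi / (2 * k + 1)) =
      ∑ i ∈ Finset.Ico 1 (k + 1), F (i * Real.pi / (2 * k + 1)) +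
        ∑ i ∈ Finset.Ico (k + 1) (2 * k + 1), F (i * Real.pi / (2 * k + 1)) := by
    rw [Finset.sum_Ico_consecutive _ (by lia) (by lia), Finset.range_eq_Ico,
      Finset.sum_eq_sum_Ico_succ_bot (by lia)]
    simp [h0]
  have h2 : ∑ i ∈ Finset.Ico (k + 1) (2 * k + 1), F (i * Real.pi / (2 * k + 1)) =
      ∑ i ∈ Finset.Ico 1 (k + 1), F (i * Real.pi / (2 * k + 1)) := by
    refine Finset.sum_bij' (fun i _ => 2 * k + 1 - i) (fun i _ => 2 * k + 1 - i) ?_ ?_ ?_ ?_ ?_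
    · intro i hi; simp only [Finset.mem_Ico] at hi ⊢; lia
    · intro i hi; simp only [Finset.mem_Ico] at hi ⊢; lia
    · intro i hi; simp only [Finset.mem_Ico] at hi; lia
    · intro i hi; simp only [Finset.mem_Ico] at hi; lia
    · intro i hi
      simp only [Finset.mem_Ico] at hi
      rw [← hF]
      congr 1
      rw [Nat.cast_sub (by lia)]
      push_cast
      have : (2 * (k : ℝ) + 1) ≠ 0 := by positivity
      field_simp
  have h3 : Finset.Icc 1 k = Finset.Ico 1 (k + 1) := by ext; simp
  rw [h1, h2, h3]
  ring

/-- Writing `sin² = 1 - cos²` raises the exponent to `p + 1`, which must stay below the number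
`2k+1` of nodes. The node `θ = 0` drops out since the sine vanishes there. -/
theorem integral_sin_sq_mul_cos_pow {k p : ℕ} (h : p < 2 * k) :
    ∫ θ in (0 : ℝ)..(Real.pi / 2), Real.sin θ ^ 2 * Real.cos θ ^ (2 * p) =
      Real.pi / (2 * k + 1) * ∑ i ∈ Finset.Icc 1 k,
        Real.sin (i * Real.pi / (2 * k + 1)) ^ 2 * Real.cos (i * Real.pi / (2 * k + 1)) ^ (2 * p) := by
  have key : ∀ θ : ℝ, Real.sin θ ^ 2 * Real.cos θ ^ (2 * p) =
      Real.cos θ ^ (2 * p) - Real.cos θ ^ (2 * (p + 1)) := by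
    intro θ; rw [Real.sin_sq]; ring
  have hr := sum_range_reflect_pi (k := k) (F := fun θ => Real.sin θ ^ 2 * Real.cos θ ^ (2 * p))
    (by simp) (by intro θ; simp [Real.sin_pi_sub, Real.cos_pi_sub, pow_mul])
  have hi : ∀ p : ℕ, IntervalIntegrable
      (fun θ : ℝ => Real.cos θ ^ (2 * p)) volume 0 (Real.pi / 2) :=
    fun q => Continuous.intervalIntegrable (by fun_prop) _ _
  have h1 := integral_cos_pow_eq_sum (n := 2 * k + 1) (p := p) (by lia)
  have h2 := integral_cos_pow_eq_sum (n := 2 * k + 1) (p := p + 1) (by lia)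
  have hs : ∑ i ∈ Finset.Icc 1 k, Real.sin (i * Real.pi / (2 * k + 1)) ^ 2 *
      Real.cos (i * Real.pi / (2 * k + 1)) ^ (2 * p) =
      1 / 2 * (∑ i ∈ Finset.range (2 * k + 1), Real.cos (i * Real.pi / (2 * k + 1)) ^ (2 * p) -
      ∑ i ∈ Finset.range (2 * k + 1), Real.cos (i * Real.pi / (2 * k + 1)) ^ (2 * (p + 1))) := by
    rw [← Finset.sum_sub_distrib]
    simp only [← key]
    rw [hr]; ring
  rw [hs]
  push_cast at h1 h2
  simp_rw [key]
  rw [intervalIntegral.integral_sub (hi _) (hi _), h1, h2]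
  have : (2 * (k : ℝ) + 1) ≠ 0 := by positivity
  field_simp

/-! ### Sphere integrals of polynomials -/

variable {d : ℕ}

instance : IsFiniteMeasure (surfaceMeasure d) := by unfold surfaceMeasure; infer_instance

/-- The surface measure of a set is a multiple of the volume of the cone over it, and volume is
invariant under negation. -/
theorem measurePreserving_neg_surfaceMeasure (d : ℕ) :
    MeasurePreserving (fun x : Metric.sphere (0 : CubSpace d) 1 => -x)
      (surfaceMeasure d) (surfaceMeasure d) := by
  have hm : Measurable (fun x : Metric.sphere (0 : CubSpace d) 1 => -x) :=
    continuous_neg.measurable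
  refine ⟨hm, ?_⟩
  ext s hs
  rw [Measure.map_apply hm hs, surfaceMeasure, Measure.toSphere_apply' _ hs,
    Measure.toSphere_apply' _ (hm hs)]
  congr 1
  rw [← Measure.measure_neg (volume : Measure (CubSpace d))]
  congr 1
  ext x
  simp only [Set.mem_neg, Set.mem_smul, Set.mem_image, Set.mem_preimage]
  constructor
  · rintro ⟨r, hr, _, ⟨y, hy, rfl⟩, h⟩
    exact ⟨r, hr, _, ⟨-y, hy, rfl⟩, by simp [h]⟩
  · rintro ⟨r, hr, _, ⟨y, hy, rfl⟩, h⟩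
    exact ⟨r, hr, _, ⟨-y, by simpa using hy, rfl⟩, by simp [h]⟩

theorem integral_surfaceMeasure_eq_zero_of_odd {f : Metric.sphere (0 : CubSpace d) 1 → ℝ}
    (hf : ∀ x, f (-x) = -f x) : ∫ x, f x ∂(surfaceMeasure d) = 0 := by
  have h := (measurePreserving_neg_surfaceMeasure d).integral_comp
    (Homeomorph.neg (Metric.sphere (0 : CubSpace d) 1)).measurableEmbedding f
  simp only [hf, integral_neg] at h
  linarith

theorem sphereArea_pos (hd : 1 ≤ d) : 0 < sphereArea d := by
  have : Nonempty (Fin d) := ⟨⟨0, hd⟩⟩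
  rw [sphereArea, measureReal_def]
  refine ENNReal.toReal_pos ?_ (measure_ne_top _ _)
  rw [Ne, Measure.measure_univ_eq_zero, surfaceMeasure]
  exact Measure.toSphere_ne_zero _

theorem continuous_polyVal (f : MvPolynomial (Fin d) ℝ) : Continuous (polyVal f) := by
  unfold polyVal
  exact (MvPolynomial.continuous_eval f).comp (by fun_prop)

theorem polyVal_mul (f g : MvPolynomial (Fin d) ℝ) (x : CubSpace d) :
    polyVal (f * g) x = polyVal f x * polyVal g x := by simp [polyVal]

theorem polyVal_sum {ι : Type*} (s : Finset ι) (f : ι → MvPolynomial (Fin d) ℝ) (x : CubSpace d) :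
    polyVal (∑ i ∈ s, f i) x = ∑ i ∈ s, polyVal (f i) x := by simp [polyVal]

theorem MvPolynomial.IsHomogeneous.polyVal_smul {f : MvPolynomial (Fin d) ℝ} {n : ℕ}
    (hf : f.IsHomogeneous n) (r : ℝ) (x : CubSpace d) :
    polyVal f (r • x) = r ^ n * polyVal f x := by
  simp only [polyVal, MvPolynomial.eval_eq, Finset.mul_sum]
  refine Finset.sum_congr rfl fun m hm => ?_
  have := hf (MvPolynomial.mem_support_iff.mp hm)
  simp only [PiLp.smul_apply, smul_eq_mul, mul_pow, Finset.prod_mul_distrib,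
    Finset.prod_pow_eq_pow_sum]
  have e : ∑ i ∈ m.support, m i = n := by
    rw [← this, Finsupp.weight_apply, Finsupp.sum]
    simp
  rw [e]
  ring

theorem sum_range_homogeneousComponent {f : MvPolynomial (Fin d) ℝ} {t : ℕ}
    (hf : f.totalDegree ≤ t) :
    ∑ j ∈ Finset.range (t + 1), MvPolynomial.homogeneousComponent j f = f := by
  conv_rhs => rw [← MvPolynomial.sum_homogeneousComponent f]
  symm
  apply Finset.sum_subset
  · intro i; simp only [Finset.mem_range]; lia
  · intro i _ hi
    simp only [Finset.mem_range] at hi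
    exact MvPolynomial.homogeneousComponent_eq_zero _ _ (by lia)

/-- The integral over the unit sphere of the homogeneous component of degree `j`. -/
noncomputable def sphereMoment (f : MvPolynomial (Fin d) ℝ) (j : ℕ) : ℝ :=
  ∫ x : Metric.sphere (0 : CubSpace d) 1,
    polyVal (MvPolynomial.homogeneousComponent j f) x ∂(surfaceMeasure d)

theorem sphereMoment_odd (f : MvPolynomial (Fin d) ℝ) {j : ℕ} (hj : Odd j) :
    sphereMoment f j = 0 := by
  refine integral_surfaceMeasure_eq_zero_of_odd fun x => ?_
  have h := (MvPolynomial.homogeneousComponent_isHomogeneous j f).polyVal_smul (-1) x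
  rw [hj.neg_one_pow] at h
  simpa using h

theorem sphereMoment_zero (f : MvPolynomial (Fin d) ℝ) :
    sphereMoment f 0 = sphereArea d * polyVal f 0 := by
  have h : polyVal f 0 = f.coeff 0 := DFunLike.congr_fun MvPolynomial.eval_zero' f
  rw [h]
  simp [sphereMoment, MvPolynomial.homogeneousComponent_zero, polyVal, sphereArea]

theorem integrable_polyVal_sphere (f : MvPolynomial (Fin d) ℝ) (r : ℝ) :
    Integrable (fun x : Metric.sphere (0 : CubSpace d) 1 => polyVal f (r • (x : CubSpace d)))
      (surfaceMeasure d) := by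
  have hc : Continuous fun x : Metric.sphere (0 : CubSpace d) 1 =>
      polyVal f (r • (x : CubSpace d)) := (continuous_polyVal f).comp (by fun_prop)
  exact hc.integrable_of_hasCompactSupport (HasCompactSupport.of_compactSpace _)

theorem integral_polyVal_sphere {f : MvPolynomial (Fin d) ℝ} {n : ℕ}
    (hf : f.totalDegree ≤ 2 * n + 1) (r : ℝ) :
    ∫ x : Metric.sphere (0 : CubSpace d) 1, polyVal f (r • (x : CubSpace d)) ∂(surfaceMeasure d) =
      ∑ m ∈ Finset.range (n + 1), sphereMoment f (2 * m) * r ^ (2 * m) := by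
  have h1 : ∀ x : Metric.sphere (0 : CubSpace d) 1, polyVal f (r • (x : CubSpace d)) =
      ∑ j ∈ Finset.range (2 * n + 2),
        polyVal (MvPolynomial.homogeneousComponent j f) (r • (x : CubSpace d)) := by
    intro x
    rw [← polyVal_sum, sum_range_homogeneousComponent hf]
  simp_rw [h1]
  rw [integral_finsetSum _ fun j _ => integrable_polyVal_sphere _ r]
  have h2 : ∀ j, ∫ x : Metric.sphere (0 : CubSpace d) 1,
      polyVal (MvPolynomial.homogeneousComponent j f) (r • (x : CubSpace d)) ∂(surfaceMeasure d) =
      sphereMoment f j * r ^ j := by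
    intro j
    simp_rw [(MvPolynomial.homogeneousComponent_isHomogeneous j f).polyVal_smul]
    rw [integral_const_mul, mul_comm, sphereMoment]
  simp_rw [h2]
  clear h1 h2 hf
  induction n with
  | zero =>
    rw [Finset.sum_range_succ, Finset.sum_range_succ, Finset.sum_range_zero,
      Finset.sum_range_succ, sphereMoment_odd f (j := 2 * 0 + 1) (by decide)]
    simp
  | succ n ih =>
    rw [show 2 * (n + 1) + 2 = (2 * n + 2) + 1 + 1 by ring, Finset.sum_range_succ,
      Finset.sum_range_succ, ih, sphereMoment_odd f (j := 2 * n + 2 + 1) ⟨n + 1, by ring⟩,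
      Finset.sum_range_succ (n := n + 1)]
    simp [mul_add]

/-! ### The radial integral and its quadrature -/

theorem image_one_div_cos_Ioo :
    (fun θ : ℝ => 1 / Real.cos θ) '' Set.Ioo 0 (Real.pi / 2) = Set.Ioi 1 := by
  ext r
  simp only [Set.mem_image, Set.mem_Ioo, Set.mem_Ioi]
  constructor
  · rintro ⟨θ, ⟨h0, h1⟩, rfl⟩
    have hc : 0 < Real.cos θ := Real.cos_pos_of_mem_Ioo ⟨by linarith, h1⟩
    have hc1 : Real.cos θ < 1 := by
      rw [← Real.cos_zero]
      exact Real.cos_lt_cos_of_nonneg_of_le_pi_div_two le_rfl h1.le h0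
    exact (one_lt_div hc).mpr hc1
  · intro hr
    have h0 : 0 < r := by linarith
    have hr1 : r⁻¹ < 1 := inv_lt_one_of_one_lt₀ hr
    have hr0 : 0 < r⁻¹ := inv_pos.mpr h0
    refine ⟨Real.arccos r⁻¹, ⟨Real.arccos_pos.mpr hr1, Real.arccos_lt_pi_div_two.mpr hr0⟩, ?_⟩
    rw [Real.cos_arccos (by linarith) hr1.le]
    simp

theorem injOn_one_div_cos :
    Set.InjOn (fun θ : ℝ => 1 / Real.cos θ) (Set.Ico 0 (Real.pi / 2)) := by
  intro a ha b hb h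
  simp only [one_div, inv_inj] at h
  have hp := Real.pi_pos
  exact Real.injOn_cos ⟨ha.1, by linarith [ha.2]⟩ ⟨hb.1, by linarith [hb.2]⟩ h

theorem hasDerivAt_one_div_cos {θ : ℝ} (h : Real.cos θ ≠ 0) :
    HasDerivAt (fun θ : ℝ => 1 / Real.cos θ) (Real.sin θ / Real.cos θ ^ 2) θ := by
  simpa [one_div] using (Real.hasDerivAt_cos θ).fun_inv h

theorem radial_substitution (hd : 1 ≤ d) {k m : ℕ} (hm : m ≤ 2 * k) {θ : ℝ}
    (hθ : θ ∈ Set.Ioo 0 (Real.pi / 2)) :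
    |Real.sin θ / Real.cos θ ^ 2| • ((1 / Real.cos θ) ^ (2 * m) *
      ((1 / Real.cos θ) ^ (d - 1) * specialWeight d k (1 / Real.cos θ))) =
    Real.sin θ ^ 2 * Real.cos θ ^ (2 * (2 * k - m)) := by
  have hc : 0 < Real.cos θ := Real.cos_pos_of_mem_Ioo ⟨by linarith [hθ.1, Real.pi_pos], hθ.2⟩
  have hs : 0 < Real.sin θ := Real.sin_pos_of_pos_of_lt_pi hθ.1 (by linarith [hθ.2, Real.pi_pos])
  have hq : √((1 / Real.cos θ) ^ 2 - 1) = Real.sin θ / Real.cos θ := by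
    rw [show (1 / Real.cos θ) ^ 2 - 1 = (Real.sin θ / Real.cos θ) ^ 2 by
      rw [div_pow, div_pow, Real.sin_sq]; field_simp]
    exact Real.sqrt_sq (by positivity)
  rw [specialWeight, hq, abs_of_pos (by positivity), smul_eq_mul]
  -- Writing `d = 1 + e` and `2k = m + p` removes the truncated subtractions.
  obtain ⟨e, rfl⟩ := Nat.exists_eq_add_of_le hd
  obtain ⟨p, hp⟩ := Nat.exists_eq_add_of_le hm
  have h2 : 2 * k - m = p := by lia
  rw [h2, Nat.add_sub_cancel_left, show 4 * k + (1 + e) + 2 = 2 * m + e + 2 * p + 3 by lia]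
  simp only [one_div, inv_pow, pow_add]
  field_simp

theorem integrableOn_radial (hd : 1 ≤ d) {k m : ℕ} (hm : m ≤ 2 * k) :
    IntegrableOn (fun r : ℝ => r ^ (2 * m) * (r ^ (d - 1) * specialWeight d k r)) (Set.Ici 1) := by
  rw [integrableOn_Ici_iff_integrableOn_Ioi, ← image_one_div_cos_Ioo,
    integrableOn_image_iff_integrableOn_abs_deriv_smul measurableSet_Ioo
      (fun θ hθ => (hasDerivAt_one_div_cos (Real.cos_pos_of_mem_Ioo
        ⟨by linarith [hθ.1, Real.pi_pos], hθ.2⟩).ne').hasDerivWithinAt)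
      (injOn_one_div_cos.mono Set.Ioo_subset_Ico_self),
    integrableOn_congr_fun (fun θ hθ => radial_substitution hd hm hθ) measurableSet_Ioo]
  exact (Continuous.integrableOn_Icc (by fun_prop)).mono_set Set.Ioo_subset_Icc_self

theorem integral_radial (hd : 1 ≤ d) {k m : ℕ} (hm : m ≤ 2 * k) :
    ∫ r in Set.Ici (1 : ℝ), r ^ (2 * m) * (r ^ (d - 1) * specialWeight d k r) =
      ∫ θ in (0 : ℝ)..(Real.pi / 2), Real.sin θ ^ 2 * Real.cos θ ^ (2 * (2 * k - m)) := by
  rw [integral_Ici_eq_integral_Ioi, ← image_one_div_cos_Ioo,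
    integral_image_eq_integral_abs_deriv_smul measurableSet_Ioo
      (fun θ hθ => (hasDerivAt_one_div_cos (Real.cos_pos_of_mem_Ioo
        ⟨by linarith [hθ.1, Real.pi_pos], hθ.2⟩).ne').hasDerivWithinAt)
      (injOn_one_div_cos.mono Set.Ioo_subset_Ico_self),
    setIntegral_congr_fun measurableSet_Ioo (fun θ hθ => radial_substitution hd hm hθ),
    intervalIntegral.integral_of_le (by positivity), integral_Ioc_eq_integral_Ioo]

theorem layerAngle_mem {k i : ℕ} (hi : i ∈ Set.Icc 1 k) :
    (i * Real.pi / (2 * k + 1) : ℝ) ∈ Set.Ioo 0 (Real.pi / 2) := by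
  have hp := Real.pi_pos
  have h1 : (1 : ℝ) ≤ i := by exact_mod_cast hi.1
  have h2 : (i : ℝ) ≤ k := by exact_mod_cast hi.2
  have h3 : (0 : ℝ) < 2 * k + 1 := by positivity
  refine ⟨by positivity, ?_⟩
  rw [div_lt_div_iff₀ h3 two_pos]
  nlinarith

theorem injOn_layerRadius (k : ℕ) : Set.InjOn (layerRadius k) (Set.Icc 1 k) := by
  intro i hi j hj h
  have := injOn_one_div_cos (Set.Ioo_subset_Ico_self (layerAngle_mem hi))
    (Set.Ioo_subset_Ico_self (layerAngle_mem hj)) h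
  have hp := Real.pi_pos.ne'
  have h3 : (2 * (k : ℝ) + 1) ≠ 0 := by positivity
  field_simp at this
  exact_mod_cast this

theorem layerRadius_pos {k i : ℕ} (hi : i ∈ Set.Icc 1 k) : 0 < layerRadius k i := by
  have h := layerAngle_mem hi
  exact one_div_pos.mpr (Real.cos_pos_of_mem_Ioo ⟨by linarith [h.1, Real.pi_pos], h.2⟩)

/-- The weight at `layerRadius k i` of the quadrature rule for the radial part. -/
noncomputable def layerWeight (k i : ℕ) : ℝ :=
  Real.pi / (2 * k + 1) * Real.sin (i * Real.pi / (2 * k + 1)) ^ 2 *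
    Real.cos (i * Real.pi / (2 * k + 1)) ^ (4 * k)

theorem layerWeight_pos {k i : ℕ} (hi : i ∈ Set.Icc 1 k) : 0 < layerWeight k i := by
  have h := layerAngle_mem hi
  have hc := Real.cos_pos_of_mem_Ioo ⟨by linarith [h.1, Real.pi_pos], h.2⟩
  have hs := Real.sin_pos_of_pos_of_lt_pi h.1 (by linarith [h.2, Real.pi_pos])
  have := Real.pi_pos
  unfold layerWeight
  positivity

theorem integral_radial_eq_sum (hd : 1 ≤ d) {k m : ℕ} (h0 : m ≠ 0) (hm : m ≤ 2 * k) :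
    ∫ r in Set.Ici (1 : ℝ), r ^ (2 * m) * (r ^ (d - 1) * specialWeight d k r) =
      ∑ i ∈ Finset.Icc 1 k, layerWeight k i * layerRadius k i ^ (2 * m) := by
  rw [integral_radial hd hm, integral_sin_sq_mul_cos_pow (k := k) (p := 2 * k - m) (by lia), Finset.mul_sum]
  refine Finset.sum_congr rfl fun i hi => ?_
  have hθ := layerAngle_mem (k := k) (i := i) (by simpa using hi)
  have hc := Real.cos_pos_of_mem_Ioo ⟨by linarith [hθ.1, Real.pi_pos], hθ.2⟩
  rw [layerWeight, layerRadius, show 4 * k = 2 * (2 * k - m) + 2 * m by lia, pow_add, one_div,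
    inv_pow]
  generalize (i * Real.pi / (2 * k + 1) : ℝ) = θ at hc ⊢
  field_simp

theorem sphericalIntegrand_eq {f : MvPolynomial (Fin d) ℝ} {k : ℕ}
    (hf : f.totalDegree ≤ 4 * k + 1) (r : ℝ) :
    (∫ x : Metric.sphere (0 : CubSpace d) 1, polyVal f (r • (x : CubSpace d)) ∂(surfaceMeasure d)) *
      (r ^ (d - 1) * specialWeight d k r) =
    ∑ m ∈ Finset.range (2 * k + 1),
      sphereMoment f (2 * m) * (r ^ (2 * m) * (r ^ (d - 1) * specialWeight d k r)) := by
  rw [integral_polyVal_sphere (n := 2 * k) (by lia), Finset.sum_mul]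
  exact Finset.sum_congr rfl fun m _ => by ring

/-- The sphere integral kills the odd components before integration in `r`, so only powers up to `r
^ (4k)` must be integrable. -/
theorem integrableOn_sphericalIntegrand (hd : 1 ≤ d) {f : MvPolynomial (Fin d) ℝ} {k : ℕ}
    (hf : f.totalDegree ≤ 4 * k + 1) :
    IntegrableOn (fun r => (∫ x : Metric.sphere (0 : CubSpace d) 1,
      polyVal f (r • (x : CubSpace d)) ∂(surfaceMeasure d)) *
      (r ^ (d - 1) * specialWeight d k r)) (Set.Ici 1) := by
  simp_rw [sphericalIntegrand_eq hf]
  refine integrable_finsetSum _ fun m hm => ?_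
  exact (integrableOn_radial hd (by simpa [Nat.lt_succ_iff] using hm)).const_mul _

/-- The constant `c` absorbs the quadrature error of the zeroth radial moment, whose coefficient is
`sphereArea d * polyVal f 0`. -/
theorem exists_specialIntegral_eq_sum (hd : 1 ≤ d) (k : ℕ) :
    ∃ c : ℝ, ∀ f : MvPolynomial (Fin d) ℝ, f.totalDegree ≤ 4 * k + 1 →
      specialIntegral d k (polyVal f) = c * polyVal f 0 + ∑ i ∈ Finset.Icc 1 k, layerWeight k i *
        ∫ x : Metric.sphere (0 : CubSpace d) 1,
          polyVal f (layerRadius k i • (x : CubSpace d)) ∂(surfaceMeasure d) := by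
  set J : ℕ → ℝ := fun m =>
    ∫ r in Set.Ici (1 : ℝ), r ^ (2 * m) * (r ^ (d - 1) * specialWeight d k r) with hJ
  refine ⟨(J 0 - ∑ i ∈ Finset.Icc 1 k, layerWeight k i) * sphereArea d, fun f hf => ?_⟩
  have h1 : specialIntegral d k (polyVal f) =
      ∑ m ∈ Finset.range (2 * k + 1), sphereMoment f (2 * m) * J m := by
    rw [specialIntegral, sphericalIntegral]
    simp_rw [sphericalIntegrand_eq hf]
    rw [integral_finsetSum _ fun m hm =>
      (integrableOn_radial hd (by simpa [Nat.lt_succ_iff] using hm)).const_mul _]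
    simp_rw [integral_const_mul]
    rfl
  have h2 : ∑ i ∈ Finset.Icc 1 k, layerWeight k i *
        ∫ x : Metric.sphere (0 : CubSpace d) 1,
          polyVal f (layerRadius k i • (x : CubSpace d)) ∂(surfaceMeasure d) =
      ∑ m ∈ Finset.range (2 * k + 1), sphereMoment f (2 * m) *
        ∑ i ∈ Finset.Icc 1 k, layerWeight k i * layerRadius k i ^ (2 * m) := by
    simp_rw [integral_polyVal_sphere (f := f) (n := 2 * k) (by lia), Finset.mul_sum]
    rw [Finset.sum_comm]
    exact Finset.sum_congr rfl fun m _ => Finset.sum_congr rfl fun i _ => by ring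
  rw [h1, h2, Finset.sum_range_succ', Finset.sum_range_succ']
  have h3 : ∀ m ∈ Finset.range (2 * k), sphereMoment f (2 * (m + 1)) * J (m + 1) =
      sphereMoment f (2 * (m + 1)) *
        ∑ i ∈ Finset.Icc 1 k, layerWeight k i * layerRadius k i ^ (2 * (m + 1)) := by
    intro m hm
    rw [hJ]
    simp only
    rw [integral_radial_eq_sum hd (by lia) (by simp at hm; lia)]
  rw [Finset.sum_congr rfl h3]
  simp only [mul_zero, pow_zero, mul_one, sphereMoment_zero]
  ring

/-! ### Parity and definiteness of the integral -/

theorem specialIntegral_eq_zero_of_odd (d k : ℕ) {f : CubSpace d → ℝ}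
    (hf : ∀ x, f (-x) = -f x) : specialIntegral d k f = 0 := by
  rw [specialIntegral, sphericalIntegral]
  have : ∀ r : ℝ, ∫ x : Metric.sphere (0 : CubSpace d) 1,
      f (r • (x : CubSpace d)) ∂(surfaceMeasure d) = 0 := fun r =>
    integral_surfaceMeasure_eq_zero_of_odd fun x => by
      rw [← hf]; simp
  simp [this]

/-- The special integral is strictly positive on squares, modulo vanishing on the region. -/
theorem eq_zero_of_specialIntegral_sq_eq_zero (hd : 1 ≤ d) {k : ℕ} {f : MvPolynomial (Fin d) ℝ}
    (hf : f.totalDegree ≤ 2 * k) (h : specialIntegral d k (polyVal (f * f)) = 0)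
    {x : CubSpace d} (hx : 1 ≤ ‖x‖) : polyVal f x = 0 := by
  have hdeg : (f * f).totalDegree ≤ 4 * k + 1 :=
    (MvPolynomial.totalDegree_mul f f).trans (by lia)
  set q : ℝ → ℝ := fun r => ∫ x : Metric.sphere (0 : CubSpace d) 1,
    polyVal (f * f) (r • (x : CubSpace d)) ∂(surfaceMeasure d) with hq
  have hq0 : ∀ r, 0 ≤ q r := fun r => integral_nonneg fun x => by
    simp only [polyVal_mul]; exact mul_self_nonneg _
  have hqc : Continuous q := by
    have : q = fun r => ∑ m ∈ Finset.range (2 * k + 1), sphereMoment (f * f) (2 * m) * r ^ (2 * m) :=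
      funext fun r => integral_polyVal_sphere (by lia) r
    rw [this]; fun_prop
  have hae : (fun r => q r * (r ^ (d - 1) * specialWeight d k r)) =ᵐ[volume.restrict (Set.Ioi 1)]
      0 := by
    have h' := h
    rw [specialIntegral, sphericalIntegral, integral_Ici_eq_integral_Ioi] at h'
    refine (setIntegral_eq_zero_iff_of_nonneg_ae ?_
      ((integrableOn_sphericalIntegrand hd hdeg).mono_set Set.Ioi_subset_Ici_self)).mp h'
    filter_upwards [ae_restrict_mem measurableSet_Ioi] with r hr
    have : (0 : ℝ) < r := lt_trans one_pos hr
    have h1 := hq0 r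
    simp only [Pi.zero_apply, specialWeight]
    positivity
  have hq1 : ∀ r, 1 < r → q r = 0 := by
    have hae' : q =ᵐ[volume.restrict (Set.Ioi 1)] 0 := by
      filter_upwards [hae, ae_restrict_mem measurableSet_Ioi] with r h1 hr
      have hr' : (1 : ℝ) < r := hr
      have h0 : (0 : ℝ) < r := by linarith
      have hs : 0 < √(r ^ 2 - 1) := Real.sqrt_pos.mpr (by nlinarith)
      have : 0 < r ^ (d - 1) * specialWeight d k r := by
        unfold specialWeight; positivity
      exact (mul_eq_zero.mp h1).resolve_right this.ne'
    exact fun r hr => Measure.eqOn_open_of_ae_eq hae' isOpen_Ioi hqc.continuousOn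
      continuousOn_const hr
  -- The weight vanishes at `r = 1`, so the boundary sphere is reached by continuity.
  have hq2 : q ‖x‖ = 0 := by
    have hcl : Set.EqOn q 0 (closure (Set.Ioi 1)) :=
      Set.EqOn.closure (fun r hr => hq1 r hr) hqc continuous_const
    rw [closure_Ioi] at hcl
    exact hcl hx
  have hc : Continuous fun y : Metric.sphere (0 : CubSpace d) 1 =>
      polyVal (f * f) (‖x‖ • (y : CubSpace d)) := (continuous_polyVal _).comp (by fun_prop)
  have : (surfaceMeasure d).IsOpenPosMeasure := by unfold surfaceMeasure; infer_instance
  have h3 := (Continuous.ae_eq_iff_eq (surfaceMeasure d) hc continuous_zero).mp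
    ((integral_eq_zero_iff_of_nonneg (fun y => by
      simp only [polyVal_mul]; exact mul_self_nonneg _) (integrable_polyVal_sphere _ _)).mp hq2)
  have hx0 : ‖x‖ ≠ 0 := by linarith
  have h4 := congrFun h3 ⟨‖x‖⁻¹ • x, by simp [norm_smul, hx0]⟩
  simpa [smul_smul, hx0, polyVal_mul] using h4

/-! ### Dimension counts and weighted orthogonality -/

/-- On `A`, the map `g` factors through `f`. This serves to compare restriction to the region with
restriction to the nodes. -/
theorem finrank_map_le_finrank_map_of_ker_le {K M N P : Type*} [Field K] [AddCommGroup M]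
    [Module K M] [AddCommGroup N] [Module K N] [AddCommGroup P] [Module K P]
    [FiniteDimensional K N] (A : Submodule K M) (f : M →ₗ[K] N) (g : M →ₗ[K] P)
    (h : ∀ a ∈ A, f a = 0 → g a = 0) :
    Module.finrank K (A.map g) ≤ Module.finrank K (A.map f) := by
  have hker : LinearMap.ker (f.domRestrict A) ≤ LinearMap.ker (g.domRestrict A) :=
    fun a ha => h a a.2 ha
  have e := (f.domRestrict A).quotKerEquivRange
  have : Module.Finite K (A ⧸ LinearMap.ker (f.domRestrict A)) := Module.Finite.equiv e.symm
  have h1 := LinearMap.finrank_range_le ((LinearMap.ker (f.domRestrict A)).liftQ _ hker)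
  rw [Submodule.range_liftQ, e.finrank_eq, LinearMap.range_domRestrict,
    LinearMap.range_domRestrict] at h1
  exact h1

theorem finrank_le_finrank_map_add_finrank_ker {K M N : Type*} [Field K] [AddCommGroup M]
    [Module K M] [AddCommGroup N] [Module K N] [FiniteDimensional K M]
    (V : Submodule K M) (f : M →ₗ[K] N) :
    Module.finrank K V ≤ Module.finrank K (V.map f) + Module.finrank K (LinearMap.ker f) := by
  have h1 := LinearMap.finrank_range_add_finrank_ker (f.domRestrict V)
  rw [LinearMap.range_domRestrict] at h1
  have h2 : Module.finrank K (LinearMap.ker (f.domRestrict V)) ≤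
      Module.finrank K (LinearMap.ker f) := by
    refine LinearMap.finrank_le_finrank_of_injective
      (f := (V.subtype.restrict (p := LinearMap.ker (f.domRestrict V)) (q := LinearMap.ker f)
        fun x hx => hx)) ?_
    intro x y hxy
    have h := Subtype.ext_iff.mp hxy
    exact Subtype.ext (Subtype.ext h)
  lia

section WeightedOrthogonality

variable {ι : Type*} [Fintype ι] {w : ι → ℝ} {V W : Submodule ℝ (ι → ℝ)}

theorem eq_zero_of_weighted_sum_sq_eq_zero (hw : ∀ i, 0 < w i) {v : ι → ℝ}
    (h : ∑ i, w i * v i * v i = 0) : v = 0 := by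
  funext i
  have h1 := (Finset.sum_eq_zero_iff_of_nonneg fun i _ => by
    rw [mul_assoc]; exact mul_nonneg (hw i).le (mul_self_nonneg _)).mp h i (Finset.mem_univ i)
  simpa [(hw i).ne'] using h1

theorem disjoint_of_weighted_orthogonal (hw : ∀ i, 0 < w i)
    (hVW : ∀ v ∈ V, ∀ u ∈ W, ∑ i, w i * v i * u i = 0) : Disjoint V W := by
  rw [Submodule.disjoint_def]
  exact fun v hv hv' => eq_zero_of_weighted_sum_sq_eq_zero hw (hVW v hv v hv')

theorem eq_zero_of_weighted_orthogonal (hw : ∀ i, 0 < w i)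
    (hVW : ∀ v ∈ V, ∀ u ∈ W, ∑ i, w i * v i * u i = 0)
    (hdim : Module.finrank ℝ V + Module.finrank ℝ W = Fintype.card ι) {h : ι → ℝ}
    (hV : ∀ v ∈ V, ∑ i, w i * h i * v i = 0) (hW : ∀ u ∈ W, ∑ i, w i * h i * u i = 0) :
    h = 0 := by
  have htop := Submodule.eq_top_of_disjoint V W (by simpa using hdim.ge)
    (disjoint_of_weighted_orthogonal hw hVW)
  obtain ⟨v, hv, u, hu, e⟩ := Submodule.mem_sup.mp (htop ▸ Submodule.mem_top : h ∈ V ⊔ W)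
  refine eq_zero_of_weighted_sum_sq_eq_zero hw ?_
  have h1 : ∀ i, w i * h i * h i = w i * h i * v i + w i * h i * u i := by
    intro i
    conv_lhs => rw [← e]
    rw [← e]
    simp only [Pi.add_apply]; ring
  simp_rw [h1]
  rw [Finset.sum_add_distrib, hV v hv, hW u hu, add_zero]

end WeightedOrthogonality

/-! ### Equality in Möller's bound -/

/-- A linear form that vanishes at no nonzero point of a finite set. -/
theorem exists_linear_polyVal_ne_zero (X : Finset (CubSpace d)) :
    ∃ L : MvPolynomial (Fin d) ℝ, L.totalDegree ≤ 1 ∧ (∀ x, polyVal L (-x) = -polyVal L x) ∧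
      ∀ x ∈ X, x ≠ 0 → polyVal L x ≠ 0 := by
  obtain ⟨f, hf⟩ := Module.exists_dual_forall_apply_ne_zero (K := ℝ)
    (fun x : {x : X // (x : CubSpace d) ≠ 0} => (x : CubSpace d)) (fun x => x.2)
  have hval : ∀ x, polyVal (∑ i, MvPolynomial.C (f (EuclideanSpace.single i 1)) *
      MvPolynomial.X i) x = f x := by
    intro x
    conv_rhs => rw [← (EuclideanSpace.basisFun (Fin d) ℝ).sum_repr x]
    simp [polyVal, mul_comm]
  refine ⟨∑ i, MvPolynomial.C (f (EuclideanSpace.single i 1)) * MvPolynomial.X i, ?_,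
    fun x => ?_, fun x hx h0 => ?_⟩
  · refine MvPolynomial.totalDegree_finsetSum_le fun i _ => ?_
    refine (MvPolynomial.totalDegree_mul _ _).trans ?_
    simp
  · rw [hval, hval, map_neg]
  · rw [hval]
    exact hf ⟨⟨x, hx⟩, h0⟩

/-- The space of even polynomials of degree at most `2k`. -/
noncomputable abbrev evenPoly (d k : ℕ) : Submodule ℝ (MvPolynomial (Fin d) ℝ) :=
  MvPolynomial.restrictTotalDegree (Fin d) ℝ (2 * k) ⊓ parityPoly d (2 * k)

theorem mem_evenPoly {k : ℕ} {f : MvPolynomial (Fin d) ℝ} :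
    f ∈ evenPoly d k ↔ f.totalDegree ≤ 2 * k ∧ ∀ x, polyVal f (-x) = polyVal f x := by
  rw [Submodule.mem_inf, MvPolynomial.mem_restrictTotalDegree]
  refine and_congr Iff.rfl (forall_congr' fun x => ?_)
  simp [pow_mul]

/-- For a minimal formula, the nodes contain the origin, and the even polynomials of degree at
most `2k` together with their multiples by a suitable linear form span all functions on the
nodes. -/
theorem IsMinimalFormula.zero_mem_and_eq_zero (hd : 1 ≤ d) {k : ℕ} {X : Finset (CubSpace d)}
    {w : CubSpace d → ℝ} (hX : IsMinimalFormula d k X w) :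
    (0 : CubSpace d) ∈ X ∧ ∃ L : MvPolynomial (Fin d) ℝ, L.totalDegree ≤ 1 ∧
      (∀ x, polyVal L (-x) = -polyVal L x) ∧
      ∀ h : CubSpace d → ℝ, (∀ a ∈ evenPoly d k, ∑ x ∈ X, w x * h x * polyVal a x = 0) →
        (∀ a ∈ evenPoly d k, ∑ x ∈ X, w x * h x * (polyVal L x * polyVal a x) = 0) →
        ∀ x ∈ X, h x = 0 := by
  obtain ⟨L, hL1, hLodd, hL⟩ := exists_linear_polyVal_ne_zero X
  set ev := polyRestrict (X : Set (CubSpace d)) with hev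
  set V := (evenPoly d k).map ev with hV
  set M := LinearMap.mulLeft ℝ (fun x : (X : Set (CubSpace d)) => polyVal L x) with hM
  have hw : ∀ x : (X : Set (CubSpace d)), 0 < w x := fun x => hX.isCubature.pos x x.2
  -- If `a` vanishes on the nodes, exactness on `a * a` gives integral zero, so `a` vanishes on the
  -- region.
  have hN : Module.finrank ℝ (parityPolyOn (2 * k) (specialRegion d)) ≤ Module.finrank ℝ V := by
    refine finrank_map_le_finrank_map_of_ker_le _ _ _ fun a ha h0 => ?_
    rw [mem_evenPoly] at ha
    funext x
    refine eq_zero_of_specialIntegral_sq_eq_zero hd ha.1 ?_ x.2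
    rw [hX.isCubature.exact _ ((MvPolynomial.totalDegree_mul a a).trans (by lia))]
    refine Finset.sum_eq_zero fun y hy => ?_
    have : polyVal a y = 0 := congrFun h0 ⟨y, hy⟩
    simp [polyVal_mul, this]
  have hort : ∀ v ∈ V, ∀ u ∈ V.map M, ∑ x : (X : Set (CubSpace d)), w x * v x * u x = 0 := by
    rintro _ ⟨a, ha, rfl⟩ _ ⟨_, ⟨b, hb, rfl⟩, rfl⟩
    rw [SetLike.mem_coe, mem_evenPoly] at ha hb
    -- The product is odd and its degree is at most `2k + 1 + 2k`, exactly within reach of the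
    -- formula.
    have hdeg : (a * (L * b)).totalDegree ≤ 4 * k + 1 := by
      refine (MvPolynomial.totalDegree_mul _ _).trans ?_
      have := MvPolynomial.totalDegree_mul L b
      lia
    have h1 := hX.isCubature.exact _ hdeg
    rw [specialIntegral_eq_zero_of_odd d k fun x => by
      simp only [polyVal_mul, ha.2, hb.2, hLodd]; ring] at h1
    rw [← Finset.sum_coe_sort] at h1
    rw [h1]
    refine Finset.sum_congr rfl fun x _ => ?_
    simp only [polyVal_mul, hM, hev, LinearMap.mulLeft_apply, Pi.mul_apply]
    change w x * polyVal a x * (polyVal L x * polyVal b x) = _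
    ring
  have hfc : Fintype.card (X : Set (CubSpace d)) = X.card := Fintype.card_coe X
  have hle := Submodule.finrank_add_finrank_le_of_disjoint
    (disjoint_of_weighted_orthogonal hw hort)
  rw [Module.finrank_fintype_fun_eq_card, hfc] at hle
  have hrk := finrank_le_finrank_map_add_finrank_ker V M
  have hcard := hX.card_eq
  -- Without the origin, multiplication by `L` would be injective, forcing one node more than the
  -- bound.
  have h0 : (0 : CubSpace d) ∈ X := by
    by_contra h0
    have hker : LinearMap.ker M = ⊥ := by
      rw [LinearMap.ker_eq_bot']
      intro v hv
      funext x
      have h1 := congrFun hv x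
      have h2 := hL x x.2 (fun h => h0 (h ▸ x.2))
      simpa [hM, h2] using h1
    rw [hker, finrank_bot] at hrk
    lia
  refine ⟨h0, L, hL1, hLodd, fun h hA hB x hx => ?_⟩
  -- Functions killed by `L` are supported at the origin, so `V.map M` loses at most one dimension;
  -- this is the `-1` in the bound.
  have hker : Module.finrank ℝ (LinearMap.ker M) ≤ 1 := by
    classical
    refine (Submodule.finrank_mono (t := Submodule.span ℝ
      {Pi.single (⟨0, h0⟩ : (X : Set (CubSpace d))) (1 : ℝ)}) fun v hv => ?_).trans
      ((finrank_span_le_card _).trans (by simp))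
    rw [Submodule.mem_span_singleton]
    refine ⟨v ⟨0, h0⟩, funext fun x => ?_⟩
    by_cases hx : x = ⟨0, h0⟩
    · subst hx; simp
    · have h1 := congrFun hv x
      have h2 := hL x x.2 (fun h => hx (Subtype.ext h))
      have : v x = 0 := by simpa [hM, h2] using h1
      simp [hx, this]
  have hrk' : Module.finrank ℝ V ≤ Module.finrank ℝ (V.map M) + 1 :=
    hrk.trans (Nat.add_le_add_left hker _)
  have hdim : Module.finrank ℝ V + Module.finrank ℝ (V.map M) = X.card :=
    le_antisymm hle (by omega)
  have hz := eq_zero_of_weighted_orthogonal (h := fun x => h x) hw hort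
    (hdim.trans hfc.symm) ?_ ?_
  · exact congrFun hz ⟨x, hx⟩
  · rintro _ ⟨a, ha, rfl⟩
    have := hA a ha
    rwa [← Finset.sum_coe_sort] at this
  · rintro _ ⟨_, ⟨a, ha, rfl⟩, rfl⟩
    have := hB a ha
    rwa [← Finset.sum_coe_sort] at this

/-! ### Locating the nodes and computing the layer weights -/

/-- The polynomial `g(‖x‖²)`. -/
noncomputable def radialPoly (d : ℕ) (g : Polynomial ℝ) : MvPolynomial (Fin d) ℝ :=
  Polynomial.aeval (∑ i, MvPolynomial.X i ^ 2) g

theorem polyVal_radialPoly (g : Polynomial ℝ) (x : CubSpace d) :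
    polyVal (radialPoly d g) x = g.eval (‖x‖ ^ 2) := by
  rw [polyVal, radialPoly, ← MvPolynomial.coe_aeval_eq_eval, RingHom.coe_coe,
    ← Polynomial.aeval_algHom_apply, EuclideanSpace.real_norm_sq_eq, Polynomial.aeval_def,
    Polynomial.eval₂_eq_eval_map]
  simp

theorem totalDegree_radialPoly_le (g : Polynomial ℝ) :
    (radialPoly d g).totalDegree ≤ 2 * g.natDegree := by
  rw [radialPoly, Polynomial.aeval_eq_sum_range]
  refine MvPolynomial.totalDegree_finsetSum_le fun j hj => ?_
  refine (MvPolynomial.totalDegree_smul_le _ _).trans ?_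
  refine (MvPolynomial.totalDegree_pow _ _).trans ?_
  have h : (∑ i : Fin d, (MvPolynomial.X i : MvPolynomial (Fin d) ℝ) ^ 2).totalDegree ≤ 2 :=
    MvPolynomial.totalDegree_finsetSum_le fun i _ => by simp
  rw [Finset.mem_range, Nat.lt_succ_iff] at hj
  calc _ ≤ j * 2 := Nat.mul_le_mul_left _ h
    _ ≤ _ := by lia

theorem natDegree_prod_X_sub_C_le (s : Finset ℕ) (v : ℕ → ℝ) :
    (∏ i ∈ s, (Polynomial.X - Polynomial.C (v i))).natDegree ≤ s.card := by
  refine (Polynomial.natDegree_prod_le _ _).trans ?_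
  simp

theorem integral_radialPoly_sphere (g : Polynomial ℝ) (r : ℝ) :
    ∫ x : Metric.sphere (0 : CubSpace d) 1,
      polyVal (radialPoly d g) (r • (x : CubSpace d)) ∂(surfaceMeasure d) =
      sphereArea d * g.eval (r ^ 2) := by
  have : ∀ x : Metric.sphere (0 : CubSpace d) 1,
      polyVal (radialPoly d g) (r • (x : CubSpace d)) = g.eval (r ^ 2) := by
    intro x
    rw [polyVal_radialPoly, norm_smul]
    simp
  simp [this, sphereArea]

/-- Every node of a minimal formula other than the origin lies on one of the layers. -/
theorem IsMinimalFormula.norm_mem (hd : 1 ≤ d) {k : ℕ} {X : Finset (CubSpace d)}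
    {w : CubSpace d → ℝ} (hX : IsMinimalFormula d k X w) {x : CubSpace d} (hx : x ∈ X)
    (hx0 : x ≠ 0) : ∃ i ∈ Set.Icc 1 k, ‖x‖ = layerRadius k i := by
  obtain ⟨h0, L, hL1, hLodd, hz⟩ := hX.zero_mem_and_eq_zero hd
  obtain ⟨c, hc⟩ := exists_specialIntegral_eq_sum hd k
  set g : Polynomial ℝ :=
    ∏ i ∈ Finset.Icc 1 k, (Polynomial.X - Polynomial.C (layerRadius k i ^ 2)) with hg
  have hgdeg : (radialPoly d g).totalDegree ≤ 2 * k := by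
    have := natDegree_prod_X_sub_C_le (Finset.Icc 1 k) (fun i => layerRadius k i ^ 2)
    simp only [Nat.card_Icc, Nat.add_sub_cancel] at this
    exact (totalDegree_radialPoly_le g).trans (by lia)
  have hgroot : ∀ i ∈ Finset.Icc 1 k, g.eval (layerRadius k i ^ 2) = 0 := by
    intro i hi
    rw [hg, Polynomial.eval_prod]
    exact Finset.prod_eq_zero hi (by simp)
  have hw0 : w 0 ≠ 0 := (hX.isCubature.pos 0 h0).ne'
  -- On `radialPoly d g * a` the integral reduces to `c * g(0) * a(0)`; the correction at the origin
  -- cancels exactly this. Against `L * a` it has no effect, as `L` vanishes there.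
  have hgx := hz (fun x => g.eval (‖x‖ ^ 2) - if x = 0 then c * g.eval 0 / w 0 else 0) ?_ ?_ x hx
  · simp only [hx0, if_false, sub_zero, hg, Polynomial.eval_prod, Finset.prod_eq_zero_iff] at hgx
    obtain ⟨i, hi, h⟩ := hgx
    refine ⟨i, by simpa using hi, ?_⟩
    have hr := layerRadius_pos (k := k) (i := i) (by simpa using hi)
    simp only [Polynomial.eval_sub, Polynomial.eval_X, Polynomial.eval_C, sub_eq_zero] at h
    exact (pow_left_inj₀ (norm_nonneg x) hr.le two_ne_zero).mp h
  · intro a ha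
    rw [mem_evenPoly] at ha
    have hdeg : (radialPoly d g * a).totalDegree ≤ 4 * k + 1 :=
      (MvPolynomial.totalDegree_mul _ _).trans (by lia)
    have h1 := hX.isCubature.exact _ hdeg
    rw [hc _ hdeg, Finset.sum_eq_zero (s := Finset.Icc 1 k), add_zero, polyVal_mul,
      polyVal_radialPoly, norm_zero] at h1
    · simp only [mul_sub, sub_mul, Finset.sum_sub_distrib, mul_ite, ite_mul, mul_zero, zero_mul,
        Finset.sum_ite_eq', h0, if_true]
      simp only [polyVal_mul, polyVal_radialPoly, ← mul_assoc] at h1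
      rw [← h1]
      field_simp
      simp
    · intro i hi
      have : ∀ x : Metric.sphere (0 : CubSpace d) 1,
          polyVal (radialPoly d g * a) (layerRadius k i • (x : CubSpace d)) = 0 := by
        intro x
        rw [polyVal_mul, polyVal_radialPoly, norm_smul]
        simp [hgroot i hi]
      simp [this]
  · intro a ha
    rw [mem_evenPoly] at ha
    have hL0 : polyVal L 0 = 0 := by
      have := hLodd 0
      rw [neg_zero] at this
      linarith
    have hdeg : (radialPoly d g * (L * a)).totalDegree ≤ 4 * k + 1 := by
      have := MvPolynomial.totalDegree_mul L a
      exact (MvPolynomial.totalDegree_mul _ _).trans (by lia)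
    have h1 := hX.isCubature.exact _ hdeg
    rw [specialIntegral_eq_zero_of_odd d k fun x => by
      simp only [polyVal_mul, polyVal_radialPoly, norm_neg, ha.2, hLodd]; ring] at h1
    simp only [mul_sub, sub_mul, Finset.sum_sub_distrib, mul_ite, ite_mul, mul_zero, zero_mul,
      Finset.sum_ite_eq', h0, if_true, hL0, sub_zero]
    simp only [polyVal_mul, polyVal_radialPoly, ← mul_assoc] at h1
    simp only [← mul_assoc]
    exact h1.symm

/-- The total weight of a minimal formula on each layer. -/
theorem IsMinimalFormula.sum_weight_layer (hd : 1 ≤ d) {k : ℕ} {X : Finset (CubSpace d)}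
    {w : CubSpace d → ℝ} (hX : IsMinimalFormula d k X w) {i : ℕ} (hi : i ∈ Set.Icc 1 k) :
    ∑ x ∈ X with ‖x‖ = layerRadius k i, w x = layerWeight k i * sphereArea d := by
  obtain ⟨c, hc⟩ := exists_specialIntegral_eq_sum hd k
  -- The factor `X` removes the origin, and with it the constant `c`; the product removes every
  -- layer but the `i`-th.
  set g : Polynomial ℝ := Polynomial.X *
    ∏ j ∈ (Finset.Icc 1 k).erase i, (Polynomial.X - Polynomial.C (layerRadius k j ^ 2)) with hg
  have hi' : i ∈ Finset.Icc 1 k := by simpa using hi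
  have hgdeg : (radialPoly d g).totalDegree ≤ 4 * k + 1 := by
    have h1 := natDegree_prod_X_sub_C_le ((Finset.Icc 1 k).erase i) (fun i => layerRadius k i ^ 2)
    rw [Finset.card_erase_of_mem hi', Nat.card_Icc] at h1
    have h2 : g.natDegree ≤ 1 + (k + 1 - 1 - 1) :=
      Polynomial.natDegree_mul_le_of_le Polynomial.natDegree_X_le h1
    have := hi.1
    have := hi.2
    exact (totalDegree_radialPoly_le g).trans (by lia)
  have hg0 : g.eval 0 = 0 := by simp [hg]
  have hgj : ∀ j ∈ Finset.Icc 1 k, j ≠ i → g.eval (layerRadius k j ^ 2) = 0 := by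
    intro j hj hji
    rw [hg, Polynomial.eval_mul, Polynomial.eval_prod]
    exact mul_eq_zero_of_right _
      (Finset.prod_eq_zero (Finset.mem_erase.mpr ⟨hji, hj⟩) (by simp))
  have hgi : g.eval (layerRadius k i ^ 2) ≠ 0 := by
    have hr := layerRadius_pos hi
    rw [hg, Polynomial.eval_mul, Polynomial.eval_prod, Polynomial.eval_X]
    refine mul_ne_zero (by positivity) (Finset.prod_ne_zero_iff.mpr fun j hj => ?_)
    rw [Finset.mem_erase] at hj
    have hj' : j ∈ Set.Icc 1 k := by simpa using hj.2
    simp only [Polynomial.eval_sub, Polynomial.eval_X, Polynomial.eval_C, sub_ne_zero]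
    intro h
    exact hj.1 (injOn_layerRadius k hi hj'
      ((pow_left_inj₀ hr.le (layerRadius_pos hj').le two_ne_zero).mp h)).symm
  have h1 := hX.isCubature.exact _ hgdeg
  rw [hc _ hgdeg] at h1
  simp only [integral_radialPoly_sphere] at h1
  simp only [polyVal_radialPoly, norm_zero] at h1
  rw [Finset.sum_eq_single_of_mem i hi' fun j hj hji => by rw [hgj j hj hji]; ring] at h1
  have h2 : ∑ x ∈ X, w x * g.eval (‖x‖ ^ 2) =
      (∑ x ∈ X with ‖x‖ = layerRadius k i, w x) * g.eval (layerRadius k i ^ 2) := by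
    rw [Finset.sum_mul, Finset.sum_filter]
    refine Finset.sum_congr rfl fun x hx => ?_
    split_ifs with hxi
    · rw [hxi]
    · by_cases hx0 : x = 0
      · simp [hx0, hg0]
      · obtain ⟨j, hj, hxj⟩ := hX.norm_mem hd hx hx0
        rw [hxj, hgj j (by simpa using hj) (fun h => hxi (h ▸ hxj)), mul_zero]
  rw [h2] at h1
  simp only [ne_eq, OfNat.ofNat_ne_zero, not_false_eq_true, zero_pow, hg0, mul_zero, zero_add] at h1
  exact mul_right_cancel₀ hgi (by rw [← h1]; ring)

theorem lemma4p3 (d k : ℕ) (hd : 1 ≤ d) (X : Finset (CubSpace d)) (w : CubSpace d → ℝ)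
    (h : IsMinimalFormula d k X w) :
    Set.InjOn (layerRadius k) (Set.Icc 1 k) ∧
    (fun x : CubSpace d => ‖x‖) '' (X : Set (CubSpace d)) =
      insert 0 (layerRadius k '' Set.Icc 1 k) ∧
    ∀ i ∈ Set.Icc 1 k, ∑ x ∈ X with ‖x‖ = layerRadius k i, w x =
      Real.pi * sphereArea d / (2 * k + 1) *
        Real.sin (i * Real.pi / (2 * k + 1)) ^ 2 *
        Real.cos (i * Real.pi / (2 * k + 1)) ^ (4 * k) := by
  refine ⟨injOn_layerRadius k, Set.Subset.antisymm ?_ ?_, fun i hi => ?_⟩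
  · rintro _ ⟨x, hx, rfl⟩
    by_cases hx0 : x = 0
    · simp [hx0]
    · obtain ⟨i, hi, hxi⟩ := h.norm_mem hd hx hx0
      exact Or.inr ⟨i, hi, hxi.symm⟩
  · rintro _ (rfl | ⟨i, hi, rfl⟩)
    · exact ⟨0, (h.zero_mem_and_eq_zero hd).1, norm_zero⟩
    · have hpos : ∑ x ∈ X with ‖x‖ = layerRadius k i, w x ≠ 0 := by
        rw [h.sum_weight_layer hd hi]
        exact (mul_pos (layerWeight_pos hi) (sphereArea_pos hd)).ne'
      obtain ⟨x, hx, -⟩ := Finset.exists_ne_zero_of_sum_ne_zero hpos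
      rw [Finset.mem_filter] at hx
      exact ⟨x, hx.1, hx.2⟩
  · rw [h.sum_weight_layer hd hi, layerWeight]
    ring
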